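/- Let $M$ be a matroid of rank $r$ on a finite set $E$ with a fixed linear order $<$. For $S\subseteq E$, an element $e\in E\setminus S$ is externally active if some circuit contained in $S\cup\{e\}$ has $e$ as its maximum, and externally passive otherwise; write $\mathrm{EA}(S),\mathrm{EP}(S)$ for the sets of such elements. Let $\mathrm{IA}(S)$ be the set of $i\in S$ that are externally active with respect to $E\setminus S$ in the dual matroid $M^\perp$ (with the same order on $E$). An independent set $I$ is related to a basis $B$ if $I=B\setminus Y$ for some $Y\subseteq\mathrm{IA}(B)$; two independent sets are internally related if they are related to a common basis. For independent sets put $I\le_{ext/int}J$ if either $I,J$ are internally related and $I\subseteq J$, or they are not internally related and $(I\setminus\mathrm{IA}(I))\cup\mathrm{EA}(I)\subseteq (J\setminus\mathrm{IA}(J))\cup\mathrm{EA}(J)$. A broken circuit is a circuit with its maximum element deleted; $\mathrm{NBC}(M)$ is the simplicial complex of subsets of $E$ that contain no broken circuit (the nbc sets). Every independent set $I$ is related to exactly one basis $B_I$, the relation $\le_{ext/int}$ is a partial order on the independent sets of $M$, and every nbc set is independent. For $S\subseteq E$ write $x_S=\{x_e:e\in S\}$, and similarly $y_S$, $z_S$;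 juxtaposition denotes union. Let $\Delta_M$ be the simplicial complex on $\{x_e,y_e,z_e:e\in E\}$ generated by the faces $F(I)=x_{I\cup\mathrm{EP}(I)}\,y_{B_I\setminus I}\,z_{I\cup\mathrm{EA}(I)}$, $I$ independent, and let $\Delta^{\mathrm{nbc}}_M$ be the simplicial complex generated by the sets $G(I)=y_{B_I\setminus I}\,z_I$, $I$ an nbc set. **Theorem.** (1) $\Delta^{\mathrm{nbc}}_M$ is a complex on $\{y_e,z_e:e\in E\}$. The map $I\mapsto G(I)$ is a bijection from the nbc sets onto the facets of $\Delta^{\mathrm{nbc}}_M$, and all facets have exactly $r$ elements. (2) For every linear extension $\prec$ of $\le_{ext/int}$ restricted to $\mathrm{NBC}(M)$, the corresponding ordering of the facets $G(I)$ is a shelling order: for all nbc sets $I\prec K$ there are an nbc set $J\prec K$ and an element $v\in G(K)$ with $G(I)\cap G(K)\subseteq G(J)\cap G(K)=G(K)\setminus\{v\}$. (3) $\Delta^{\mathrm{nbc}}_M$ is a subcomplex of $\Delta_M$, and it contains $\mathrm{NBC}(M)$ as its subcomplex induced on $\{z_e:e\in E\}$: a set $S$ is an nbc set if and only if $z_S$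 is a face of $\Delta^{\mathrm{nbc}}_M$. -/

import Mathlib

/-!
Simplicial complexes on a vertex type `V` are lower sets of `Set V`: families of sets of vertices
closed under taking subsets.  As in the combinatorial convention, the empty set is a face of every
complex with at least one face, and the void complex (no faces at all) is allowed.
All complexes below have finite ground set when the matroid is finite.
-/

noncomputable section

namespace AugNBC

/-- A simplicial complex with vertices in `V`. -/
abbrev Complex (V : Type*) := LowerSet (Set V)

/-- The complex generated by a family of sets. -/
def generatedBy {V : Type*} (A : Set (Set V)) : Complex V := lowerClosure A

/-- A facet is an inclusion-maximal face. -/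
def IsFacet {V : Type*} (D : Complex V) (F : Set V) : Prop := Maximal (fun G => G ∈ D) F

/-- A complex is pure if all facets have the same cardinality. -/
def IsPure {V : Type*} (D : Complex V) : Prop :=
  ∀ F G : Set V, IsFacet D F → IsFacet D G → F.encard = G.encard

/-- `F`, indexed by a finite set `ι` that is linearly ordered by `P`, lists every facet of the pure
complex `D` exactly once, and for all `i < k` there are `j < k` and `e ∈ F k` with
`F i ∩ F k ⊆ F j ∩ F k = F k \ {e}`. -/
def IsShellingOrder {V ι : Type*} (D : Complex V) (P : LinearOrder ι) (F : ι → Set V) : Prop :=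
  IsPure D ∧ Finite ι ∧ Set.BijOn F Set.univ {G | IsFacet D G} ∧
    ∀ i k : ι, P.lt i k → ∃ j : ι, P.lt j k ∧ ∃ e ∈ F k,
      F i ∩ F k ⊆ F j ∩ F k ∧ F j ∩ F k = F k \ {e}

section Activities

variable {α : Type*} [LinearOrder α] (M : Matroid α)

/-- The externally active elements of `S`. -/
def EA (S : Set α) : Set α :=
  {e | e ∈ M.E \ S ∧ ∃ γ, M.IsCircuit γ ∧ γ ⊆ insert e S ∧ IsGreatest γ e}

/-- The externally passive elements of `S`. -/
def EP (S : Set α) : Set α := (M.E \ S) \ EA M S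

/-- The internally active elements of `S`. -/
def IA (S : Set α) : Set α := {i | i ∈ S ∧ i ∈ EA M✶ (M.E \ S)}

/-- The internally passive elements of `S`. -/
def IP (S : Set α) : Set α := S \ IA M S

/-- `I = B \ Y` for the basis `B` and some set `Y` of internally active elements of `B`. -/
def RelatedToBase (I B : Set α) : Prop := M.IsBase B ∧ ∃ Y ⊆ IA M B, I = B \ Y

/-- Two sets are internally related if they are related to a common basis. -/
def InternallyRelated (I J : Set α) : Prop := ∃ B, RelatedToBase M I B ∧ RelatedToBase M J B

/-- The basis `B_I` related to the independent set `I`. -/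
def relatedBase (I : Set α) : Set α := Classical.epsilon (fun B => RelatedToBase M I B)

/-- The external/internal order on independent sets. -/
def ExtIntLE (I J : Set α) : Prop :=
  (¬ InternallyRelated M I J ∧ (I \ IA M I) ∪ EA M I ⊆ (J \ IA M J) ∪ EA M J) ∨
    (InternallyRelated M I J ∧ I ⊆ J)

/-- A broken circuit is a circuit with its maximum element deleted. -/
def IsBrokenCircuit (β : Set α) : Prop :=
  ∃ γ e, M.IsCircuit γ ∧ IsGreatest γ e ∧ β = γ \ {e}

/-- The no broken circuit complex. -/
def NBC : Complex α where
  carrier := {S | S ⊆ M.E ∧ ∀ β, IsBrokenCircuit M β → ¬ β ⊆ S}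
  lower' := fun _ _ hTS hS =>
    ⟨Set.Subset.trans hTS hS.1, fun β hβ h => hS.2 β hβ (Set.Subset.trans h hTS)⟩

end Activities

/-- The variables `x_e`, `y_e`, `z_e`. -/
inductive Vert (α : Type*) where
  | x (e : α) : Vert α
  | y (e : α) : Vert α
  | z (e : α) : Vert α

section Complexes

variable {α : Type*} [LinearOrder α] (M : Matroid α)

/-- `F(I) = x_{I ∪ EP(I)} y_{B_I \ I} z_{I ∪ EA(I)}`. -/
def extFacet (I : Set α) : Set (Vert α) :=
  Vert.x '' (I ∪ EP M I) ∪ Vert.y '' (relatedBase M I \ I) ∪ Vert.z '' (I ∪ EA M I)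

/-- The augmented external activity complex `Δ_M`. -/
def augExtComplex : Complex (Vert α) := generatedBy {F | ∃ I, M.Indep I ∧ F = extFacet M I}

/-- `G(I) = y_{B_I \ I} z_I`. -/
def nbcFacet (I : Set α) : Set (Vert α) :=
  Vert.y '' (relatedBase M I \ I) ∪ Vert.z '' I

/-- The augmented nbc complex. -/
def augNBCComplex : Complex (Vert α) := generatedBy {G | ∃ I ∈ NBC M, G = nbcFacet M I}

/-- `P` is a linear extension of the external/internal order restricted to the nbc sets. -/
def IsNBCLinearExtension (P : LinearOrder {I : Set α // I ∈ NBC M}) : Prop :=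
  ∀ I J : {I : Set α // I ∈ NBC M}, ExtIntLE M I.1 J.1 → P.le I J

end Complexes

end AugNBC

end

namespace AugNBC

open Set

/-! ### Activities and closures -/

section Activities

variable {α : Type*} [LinearOrder α] {M : Matroid α} {B B' C I J S : Set α} {e i : α}

/-! Internal activity of `i` in `S` means that `S \ {i}` and the elements above `i` do not span `i`.
Hence `B_I` must be the greedy completion of `I`, built from the largest element down
(`RelatedToBase.eq_greedyBase`).

Shrinking `I` only enlarges the set of greedy choices, so passing from `K` to `K \ {k}` keeps all
`y`-vertices of `G(K)` and loses just `z_k`. An nbc set has no externally active elements and `IP`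
is monotone, so on nbc sets the order refines inclusion. If `I ≺ K`, then `K ⊄ I`, and any `k ∈ K \
I` gives the shelling step `J = K \ {k}`.

That the relation is a partial order rests on `eq_of_IP_subset`, a descent between two bases, and on
`IP_greedyBase`: related independent sets have the same internally passive elements. -/

lemma mem_IA_iff (hS : S ⊆ M.E) : i ∈ IA M S ↔ i ∈ S ∧ i ∉ M.closure (S \ {i} ∪ Ioi i) := by
  constructor
  · rintro ⟨hi, -, D, hD, hDS, hmax⟩
    refine ⟨hi, fun hcl => ?_⟩
    obtain ⟨C, hCS, hC, hiC⟩ := Matroid.exists_isCircuit_of_mem_closure hcl (by simp)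
    refine hC.inter_isCocircuit_ne_singleton (e := i) (Matroid.isCocircuit_def.2 hD)
      (subset_antisymm ?_ (singleton_subset_iff.2 ⟨hiC, hmax.1⟩)) |>.elim
    rintro f ⟨hfC, hfD⟩
    by_contra hne
    rw [mem_singleton_iff] at hne
    have hle : f ≤ i := hmax.2 hfD
    have h1 := (hDS hfD).resolve_left hne
    rcases (hCS hfC).resolve_left hne with h | h
    · exact h1.2 h.1
    · exact not_lt_of_ge hle h
  · rintro ⟨hi, hcl⟩
    refine ⟨hi, ⟨hS hi, fun h => h.2 hi⟩, ?_⟩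
    -- For a base `B` containing `A` and `i`, the hyperplane spanned by `B \ {i}` contains `S \ {i}`
    -- and everything above `i`; its complement is the required cocircuit with maximum `i`.
    obtain ⟨A, hA⟩ := M.exists_isBasis' (S \ {i} ∪ Ioi i)
    rw [← hA.closure_eq_closure] at hcl
    have hiA : i ∉ A := fun h => hcl (M.mem_closure_of_mem' h (hS hi))
    have hind : M.Indep (insert i A) :=
      ((hA.indep.notMem_closure_iff_of_notMem hiA (hS hi)).1 hcl)
    obtain ⟨B, hB, hAB⟩ := hind.exists_isBase_superset
    have hiB : i ∈ B := hAB (mem_insert _ _)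
    have hsub : M.closure (S \ {i} ∪ Ioi i) ⊆ M.closure (B \ {i}) := by
      rw [← hA.closure_eq_closure]
      exact M.closure_subset_closure (subset_sdiff_singleton ((subset_insert _ _).trans hAB) hiA)
    have hnot : ∀ f ∈ M.E \ M.closure (B \ {i}), f ∉ S \ {i} ∪ Ioi i := fun f hf h =>
      hf.2 (hsub (M.mem_closure_of_mem' h hf.1))
    refine ⟨_, (hB.compl_closure_sdiff_singleton_isCocircuit hiB).isCircuit, ?_, ?_, ?_⟩
    · intro f hf
      by_cases hfi : f = i
      · exact Or.inl hfi
      · exact Or.inr ⟨hf.1, fun h => hnot f hf (Or.inl ⟨h, hfi⟩)⟩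
    · exact ⟨hS hi, hB.indep.notMem_closure_sdiff_of_mem hiB⟩
    · exact fun f hf => not_lt.1 fun h => hnot f hf (Or.inr h)

lemma IA_antitone (hIJ : I ⊆ J) (hJ : J ⊆ M.E) (hi : i ∈ I) (h : i ∈ IA M J) : i ∈ IA M I := by
  rw [mem_IA_iff hJ] at h
  rw [mem_IA_iff (hIJ.trans hJ)]
  exact ⟨hi, fun hcl => h.2 (M.closure_subset_closure
    (union_subset_union_left _ (sdiff_subset_sdiff_left hIJ)) hcl)⟩

lemma IP_mono (hIJ : I ⊆ J) (hJ : J ⊆ M.E) : IP M I ⊆ IP M J := fun _ hi =>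
  ⟨hIJ hi.1, fun h => hi.2 (IA_antitone hIJ hJ hi.1 h)⟩

lemma EA_mono_of_indep (hIJ : I ⊆ J) (hJ : M.Indep J) : EA M I ⊆ EA M J := by
  rintro e ⟨he, γ, hγ, hγI, hmax⟩
  refine ⟨⟨he.1, fun heJ => ?_⟩, γ, hγ, hγI.trans (insert_subset_insert hIJ), hmax⟩
  exact hγ.dep.not_indep (hJ.subset (hγI.trans (insert_subset heJ hIJ)))

lemma EA_eq_empty_of_mem_NBC (hI : I ∈ NBC M) : EA M I = ∅ := by
  refine eq_empty_of_forall_notMem ?_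
  rintro e ⟨-, γ, hγ, hγI, hmax⟩
  exact hI.2 _ ⟨γ, e, hγ, hmax, rfl⟩ (sdiff_singleton_subset_iff.2 hγI)

/-- The greedy completion of `I`: elements are scanned in decreasing order, and those that are not
spanned by `I` and the larger elements are added. -/
def greedyBase (M : Matroid α) (I : Set α) : Set α :=
  I ∪ {e | e ∈ M.E ∧ e ∉ M.closure (I ∪ Ioi e)}

lemma subset_greedyBase : I ⊆ greedyBase M I := subset_union_left

/-- A smaller set spans less, so greedy choices survive. This keeps the `y`-vertices in the shelling
step. -/
lemma greedyBase_sdiff_subset (hIJ : I ⊆ J) : greedyBase M J \ J ⊆ greedyBase M I := by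
  rintro e ⟨h | h, he⟩
  · exact (he h).elim
  · exact Or.inr ⟨h.1, fun hcl => h.2 (M.closure_subset_closure
      (union_subset_union_left _ hIJ) hcl)⟩

lemma RelatedToBase.subset (h : RelatedToBase M I B) : I ⊆ B := by
  obtain ⟨-, Y, -, rfl⟩ := h
  exact sdiff_subset

lemma RelatedToBase.sdiff_subset_IA (h : RelatedToBase M I B) : B \ I ⊆ IA M B := by
  obtain ⟨-, Y, hY, rfl⟩ := h
  intro e he
  by_contra hc
  exact he.2 ⟨he.1, fun h => hc (hY h)⟩

lemma relatedToBase_of_subset (hB : M.IsBase B) (hI : I ⊆ B) (h : B \ I ⊆ IA M B) :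
    RelatedToBase M I B :=
  ⟨hB, B \ I, h, (sdiff_sdiff_cancel_left hI).symm⟩

/-! ### The basis related to an independent set -/

section Finite

variable [M.Finite]

/-- The least element of a circuit outside `I` is spanned by `I` and the larger elements. -/
lemma exists_min_mem_closure (hC : M.IsCircuit C) (hCI : ¬ C ⊆ I) :
    ∃ f ∈ C \ I, (∀ g ∈ C \ I, f ≤ g) ∧ f ∈ M.closure (I ∪ Ioi f) := by
  have hfin : (C \ I).Finite := (M.ground_finite.subset hC.subset_ground).subset sdiff_subset
  obtain ⟨f, hf, hmin⟩ := exists_min_image (C \ I) id hfin (sdiff_nonempty.2 hCI)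
  refine ⟨f, hf, hmin, M.closure_subset_closure ?_ (hC.mem_closure_sdiff_singleton_of_mem hf.1)⟩
  rintro g ⟨hg, hgf⟩
  by_cases hgI : g ∈ I
  · exact Or.inl hgI
  · exact Or.inr (lt_of_le_of_ne (hmin g ⟨hg, hgI⟩) (Ne.symm hgf))

lemma greedyBase_isBase (hI : M.Indep I) : M.IsBase (greedyBase M I) := by
  have hE : greedyBase M I ⊆ M.E := union_subset hI.subset_ground fun e he => he.1
  have hind : M.Indep (greedyBase M I) := by
    rw [Matroid.indep_iff_forall_subset_not_isCircuit hE]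
    intro C hCB hC
    obtain ⟨f, hf, -, hcl⟩ := exists_min_mem_closure hC
      fun h : C ⊆ I => hC.dep.not_indep (hI.subset h)
    exact ((hCB hf.1).resolve_left hf.2).2 hcl
  rw [Matroid.isBase_iff_indep_closure_eq]
  refine ⟨hind, subset_antisymm (M.closure_subset_ground _) ?_⟩
  by_contra hcon
  -- The largest unspanned `e` was rejected by the greedy scan, hence is spanned by `I` and larger
  -- elements; those are all spanned already.
  obtain ⟨e, he, hmax⟩ := exists_max_image (M.E \ M.closure (greedyBase M I)) id
    (M.ground_finite.subset sdiff_subset) (sdiff_nonempty.2 hcon)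
  have heB : e ∉ greedyBase M I := fun h => he.2 (M.mem_closure_of_mem' h he.1)
  have hecl : e ∈ M.closure (I ∪ Ioi e) := by
    by_contra h
    exact heB (Or.inr ⟨he.1, h⟩)
  obtain ⟨C, hC, hCc, heC⟩ := Matroid.exists_isCircuit_of_mem_closure hecl
    (by rintro (h | h)
        · exact heB (Or.inl h)
        · exact lt_irrefl _ h)
  refine he.2 (M.closure_subset_closure_of_subset_closure ?_
    (hCc.mem_closure_sdiff_singleton_of_mem heC))
  rintro f ⟨hf, hfe⟩
  have hfE := hCc.subset_ground hf
  rcases (hC hf).resolve_left hfe with h | h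
  · exact M.mem_closure_of_mem' (Or.inl h) hfE
  · by_contra hcl
    exact not_lt_of_ge (hmax f ⟨hfE, hcl⟩) h

lemma greedyBase_related (hI : M.Indep I) : RelatedToBase M I (greedyBase M I) := by
  have hB := greedyBase_isBase hI
  refine relatedToBase_of_subset hB subset_greedyBase ?_
  rintro e ⟨heB, heI⟩
  rw [mem_IA_iff hB.subset_ground]
  refine ⟨heB, fun hcl => ?_⟩
  obtain ⟨C, hC, hCc, heC⟩ := Matroid.exists_isCircuit_of_mem_closure hcl (by simp)
  obtain ⟨f, hf, hmin, hfcl⟩ := exists_min_mem_closure hCc fun h : C ⊆ I => heI (h heC)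
  have hfB : f ∈ greedyBase M I := by
    rcases hC hf.1 with h | h | h
    · exact h ▸ heB
    · exact h.1
    · exact (not_lt_of_ge (hmin e ⟨heC, heI⟩) h).elim
  exact (hfB.resolve_left hf.2).2 hfcl

/-- Elements of `B \ I` are active in `B`, hence not spanned by `I` and the larger elements, so the
greedy scan takes them. Two nested bases are equal. -/
lemma RelatedToBase.eq_greedyBase (h : RelatedToBase M I B) : B = greedyBase M I := by
  refine h.1.eq_of_subset_isBase (greedyBase_isBase (h.1.indep.subset h.subset)) fun e he => ?_
  by_cases heI : e ∈ I
  · exact Or.inl heI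
  · have := ((mem_IA_iff h.1.subset_ground).1 (h.sdiff_subset_IA ⟨he, heI⟩)).2
    exact Or.inr ⟨h.1.subset_ground he, fun hcl => this (M.closure_subset_closure
      (union_subset_union_left _ (subset_sdiff_singleton h.subset heI)) hcl)⟩

lemma existsUnique_relatedToBase (hI : M.Indep I) : ∃! B, RelatedToBase M I B :=
  ⟨_, greedyBase_related hI, fun _ h => h.eq_greedyBase⟩

lemma relatedBase_eq (hI : M.Indep I) : relatedBase M I = greedyBase M I :=
  (Classical.epsilon_spec (p := fun B => RelatedToBase M I B)
    ⟨_, greedyBase_related hI⟩).eq_greedyBase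

lemma internallyRelated_iff (hI : M.Indep I) (hJ : M.Indep J) :
    InternallyRelated M I J ↔ greedyBase M I = greedyBase M J :=
  ⟨fun ⟨_, h1, h2⟩ => h1.eq_greedyBase.symm.trans h2.eq_greedyBase,
    fun h => ⟨_, greedyBase_related hI, h ▸ greedyBase_related hJ⟩⟩

lemma IP_greedyBase (hI : M.Indep I) : IP M (greedyBase M I) = IP M I := by
  have hB := greedyBase_isBase hI
  refine subset_antisymm ?_ (IP_mono subset_greedyBase hB.subset_ground)
  rintro i ⟨hiB, hiA⟩
  have hiI : i ∈ I := by
    by_contra h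
    exact hiA ((greedyBase_related hI).sdiff_subset_IA ⟨hiB, h⟩)
  refine ⟨hiI, fun h => hiA ?_⟩
  rw [mem_IA_iff hI.subset_ground] at h
  rw [mem_IA_iff hB.subset_ground]
  refine ⟨hiB, fun hcl => h.2 ?_⟩
  obtain ⟨C, hC, hCc, hiC⟩ := Matroid.exists_isCircuit_of_mem_closure hcl (by simp)
  refine M.closure_subset_closure ?_ (hCc.mem_closure_sdiff_singleton_of_mem hiC)
  by_cases hCI : C ⊆ I
  · exact (sdiff_subset_sdiff_left hCI).trans subset_union_left
  -- The least `f` in `C \ I` is not a greedy choice, so it entered `C` through `Ioi i`; thus all of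
  -- `C \ I` lies above `i`.
  obtain ⟨f, hf, hmin, hfcl⟩ := exists_min_mem_closure hCc hCI
  have hfi : i < f := by
    rcases hC hf.1 with h | h | h
    · exact (hf.2 (h ▸ hiI)).elim
    · exact ((h.1.resolve_left hf.2).2 hfcl).elim
    · exact h
  rintro g ⟨hg, hgi⟩
  by_cases hgI : g ∈ I
  · exact Or.inl ⟨hgI, hgi⟩
  · exact Or.inr (hfi.trans_le (hmin g ⟨hg, hgI⟩))

/-- Two bases whose internally passive sets contain only internally passive or externally active
elements of the other basis are equal. -/
lemma eq_of_IP_subset (hB : M.IsBase B) (hB' : M.IsBase B')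
    (h : IP M B ⊆ IP M B' ∪ EA M B') (h' : IP M B' ⊆ IP M B ∪ EA M B) : B = B' := by
  -- In a circuit of `B' ∪ {e}` with maximum `e`, every other element is internally passive in `B'`.
  -- If none were externally active for `B`, the whole circuit would lie in `B`.
  have step : ∀ {B B' : Set α} {e : α}, M.IsBase B → M.IsBase B' →
      IP M B' ⊆ IP M B ∪ EA M B → e ∈ IP M B → e ∈ EA M B' →
      ∃ f < e, f ∈ IP M B' ∩ EA M B := by
    rintro B B' e hB hB' h' heB ⟨heB', γ, hγ, hγB, hmax⟩
    by_contra! hcon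
    refine hγ.dep.not_indep (hB.indep.subset fun f hf => ?_)
    by_cases hfe : f = e
    · exact hfe ▸ heB.1
    have hlt : f < e := lt_of_le_of_ne (hmax.2 hf) hfe
    have hfB' : f ∈ B' := (hγB hf).resolve_left hfe
    have hfIP : f ∈ IP M B' := by
      refine ⟨hfB', fun hA => ((mem_IA_iff hB'.subset_ground).1 hA).2 ?_⟩
      refine M.closure_subset_closure ?_ (hγ.mem_closure_sdiff_singleton_of_mem hf)
      rintro g ⟨hg, hgf⟩
      rcases hγB hg with rfl | h
      · exact Or.inr hlt
      · exact Or.inl ⟨h, hgf⟩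
    rcases h' hfIP with h1 | h1
    · exact h1.1
    · exact (hcon f hlt ⟨hfIP, h1⟩).elim
  -- By `step`, each element of one intersection has a smaller one in the other, so a least element
  -- is impossible.
  have hempty : IP M B ∩ EA M B' ∪ IP M B' ∩ EA M B = ∅ := by
    by_contra hne
    have hfin : (IP M B ∩ EA M B' ∪ IP M B' ∩ EA M B).Finite := by
      refine M.ground_finite.subset (union_subset ?_ ?_)
      · exact fun e he => hB.subset_ground he.1.1
      · exact fun e he => hB'.subset_ground he.1.1
    obtain ⟨e, he, hmin⟩ := exists_min_image _ id hfin (nonempty_iff_ne_empty.2 hne)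
    rcases he with he | he
    · obtain ⟨f, hf, hf'⟩ := step hB hB' h' he.1 he.2
      exact not_lt_of_ge (hmin f (Or.inr hf')) hf
    · obtain ⟨f, hf, hf'⟩ := step hB' hB h he.1 he.2
      exact not_lt_of_ge (hmin f (Or.inl hf')) hf
  rw [union_empty_iff] at hempty
  -- Now the passive elements of each basis lie in `B ∩ B'`, so both bases are related to this one
  -- independent set.
  have key : ∀ {B B' : Set α}, M.IsBase B → IP M B ⊆ IP M B' ∪ EA M B' →
      IP M B ∩ EA M B' = ∅ → RelatedToBase M (B ∩ B') B := by
    intro B B' hB h he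
    refine relatedToBase_of_subset hB inter_subset_left fun e heB => ?_
    by_contra hA
    have h1 : e ∈ IP M B := ⟨heB.1, hA⟩
    rcases h h1 with h2 | h2
    · exact heB.2 ⟨heB.1, h2.1⟩
    · exact (he ▸ (⟨h1, h2⟩ : e ∈ IP M B ∩ EA M B') : e ∈ (∅ : Set α))
  have h1 := (key hB h hempty.1).eq_greedyBase
  have h2 := (key hB' h' hempty.2).eq_greedyBase
  rw [inter_comm] at h2
  exact h1.trans h2.symm

/-! ### The external/internal order -/

lemma extIntLE_iff (hI : M.Indep I) (hJ : M.Indep J) : ExtIntLE M I J ↔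
    (greedyBase M I ≠ greedyBase M J ∧ IP M I ∪ EA M I ⊆ IP M J ∪ EA M J) ∨
      (greedyBase M I = greedyBase M J ∧ I ⊆ J) := by
  rw [ExtIntLE, internallyRelated_iff hI hJ]; rfl

lemma ExtIntLE.passive_subset (hI : M.Indep I) (hJ : M.Indep J) (h : ExtIntLE M I J) :
    IP M I ∪ EA M I ⊆ IP M J ∪ EA M J := by
  rcases (extIntLE_iff hI hJ).1 h with h | ⟨h, hIJ⟩
  · exact h.2
  · rw [← IP_greedyBase hI, h, IP_greedyBase hJ]
    exact union_subset_union_right _ (EA_mono_of_indep hIJ hJ)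

lemma IP_greedyBase_subset (hI : M.Indep I) (hJ : M.Indep J)
    (h : IP M I ∪ EA M I ⊆ IP M J ∪ EA M J) :
    IP M (greedyBase M I) ⊆ IP M (greedyBase M J) ∪ EA M (greedyBase M J) := by
  rw [IP_greedyBase hI, IP_greedyBase hJ]
  exact (subset_union_left.trans h).trans (union_subset_union_right _
    (EA_mono_of_indep subset_greedyBase (greedyBase_isBase hJ).indep))

/-- A chain cannot leave a class of internally related sets and return to it. Transitivity needs
this when the end terms are related, antisymmetry when they coincide. -/
lemma greedyBase_eq (hI : M.Indep I) (hJ : M.Indep J) {K : Set α} (hK : M.Indep K)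
    (hIJ : IP M I ∪ EA M I ⊆ IP M J ∪ EA M J) (hJK : IP M J ∪ EA M J ⊆ IP M K ∪ EA M K)
    (hIK : greedyBase M I = greedyBase M K) : greedyBase M I = greedyBase M J := by
  refine eq_of_IP_subset (greedyBase_isBase hI) (greedyBase_isBase hJ)
    (IP_greedyBase_subset hI hJ hIJ) ?_
  rw [hIK]
  exact IP_greedyBase_subset hJ hK hJK

lemma extIntLE_trans {K : Set α} (hI : M.Indep I) (hJ : M.Indep J) (hK : M.Indep K)
    (hIJ : ExtIntLE M I J) (hJK : ExtIntLE M J K) : ExtIntLE M I K := by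
  have h1 := hIJ.passive_subset hI hJ
  have h2 := hJK.passive_subset hJ hK
  rw [extIntLE_iff hI hK]
  by_cases hIK : greedyBase M I = greedyBase M K
  · have hb := greedyBase_eq hI hJ hK h1 h2 hIK
    rcases (extIntLE_iff hI hJ).1 hIJ with h | h
    · exact (h.1 hb).elim
    rcases (extIntLE_iff hJ hK).1 hJK with h' | h'
    · exact (h'.1 (hb.symm.trans hIK)).elim
    exact Or.inr ⟨hIK, h.2.trans h'.2⟩
  · exact Or.inl ⟨hIK, h1.trans h2⟩

lemma extIntLE_antisymm (hI : M.Indep I) (hJ : M.Indep J)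
    (hIJ : ExtIntLE M I J) (hJI : ExtIntLE M J I) : I = J := by
  have hb := greedyBase_eq hI hJ hI (hIJ.passive_subset hI hJ) (hJI.passive_subset hJ hI) rfl
  rcases (extIntLE_iff hI hJ).1 hIJ with h | h
  · exact (h.1 hb).elim
  rcases (extIntLE_iff hJ hI).1 hJI with h' | h'
  · exact (h'.1 hb.symm).elim
  exact h.2.antisymm h'.2

lemma extIntLE_isPartialOrder (M : Matroid α) [M.Finite] :
    IsPartialOrder {I : Set α // M.Indep I} (fun I J => ExtIntLE M I.1 J.1) where
  refl I := (extIntLE_iff I.2 I.2).2 (Or.inr ⟨rfl, Subset.rfl⟩)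
  trans I J K := extIntLE_trans I.2 J.2 K.2
  antisymm I J h h' := Subtype.ext (extIntLE_antisymm I.2 J.2 h h')

lemma indep_of_mem_NBC (hI : I ∈ NBC M) : M.Indep I := by
  rw [Matroid.indep_iff_forall_subset_not_isCircuit hI.1]
  intro C hCI hC
  obtain ⟨e, he, hmax⟩ := exists_max_image C id (M.ground_finite.subset hC.subset_ground)
    hC.nonempty
  exact hI.2 _ ⟨C, e, hC, ⟨he, hmax⟩, rfl⟩ (sdiff_subset.trans hCI)

/-- On the nbc sets the external/internal order refines inclusion. -/
lemma extIntLE_of_subset (hJ : J ∈ NBC M) (hIJ : I ⊆ J) : ExtIntLE M I J := by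
  have hI : I ∈ NBC M := (NBC M).lower hIJ hJ
  rw [extIntLE_iff (indep_of_mem_NBC hI) (indep_of_mem_NBC hJ), EA_eq_empty_of_mem_NBC hI,
    EA_eq_empty_of_mem_NBC hJ, union_empty, union_empty]
  by_cases h : greedyBase M I = greedyBase M J
  · exact Or.inr ⟨h, hIJ⟩
  · exact Or.inl ⟨h, IP_mono hIJ hJ.1⟩

end Finite

end Activities

/-! ### The augmented nbc complex and its shellings -/

section Complexes

variable {α : Type*} [LinearOrder α] {M : Matroid α} {I J K S : Set α} {F : Set (Vert α)} {e : α}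

lemma y_mem_nbcFacet : Vert.y e ∈ nbcFacet M I ↔ e ∈ relatedBase M I \ I := by
  simp [nbcFacet]

lemma z_mem_nbcFacet : Vert.z e ∈ nbcFacet M I ↔ e ∈ I := by
  simp [nbcFacet]

lemma nbcFacet_injective : Function.Injective (nbcFacet M) := fun I J h => by
  ext e
  rw [← z_mem_nbcFacet (M := M), h, z_mem_nbcFacet]

lemma nbcFacet_subset_extFacet : nbcFacet M I ⊆ extFacet M I := by
  rintro _ (h | ⟨e, he, rfl⟩)
  · exact Or.inl (Or.inr h)
  · exact Or.inr ⟨e, Or.inl he, rfl⟩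

lemma mem_augNBCComplex : F ∈ augNBCComplex M ↔ ∃ I ∈ NBC M, F ⊆ nbcFacet M I := by
  constructor
  · rintro ⟨_, ⟨I, hI, rfl⟩, h⟩
    exact ⟨I, hI, h⟩
  · rintro ⟨I, hI, h⟩
    exact ⟨_, ⟨I, hI, rfl⟩, h⟩

lemma mem_NBC_iff_image_z_mem : S ∈ NBC M ↔ Vert.z '' S ∈ augNBCComplex M := by
  rw [mem_augNBCComplex]
  refine ⟨fun h => ⟨S, h, subset_union_right⟩, fun ⟨I, hI, h⟩ => (NBC M).lower ?_ hI⟩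
  exact fun e he => z_mem_nbcFacet.1 (h ⟨e, he, rfl⟩)

variable [M.Finite]

lemma relatedBase_related (hI : M.Indep I) : RelatedToBase M I (relatedBase M I) :=
  relatedBase_eq hI ▸ greedyBase_related hI

lemma nbcFacet_encard (hI : M.Indep I) : (nbcFacet M I).encard = M.eRank := by
  have hr := relatedBase_related hI
  rw [nbcFacet, encard_union_eq, Function.Injective.encard_image, Function.Injective.encard_image,
    encard_sdiff_add_encard_of_subset hr.subset, hr.1.encard_eq_eRank]
  · exact fun a b h => Vert.z.inj h
  · exact fun a b h => Vert.y.inj h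
  · rw [disjoint_left]
    rintro _ ⟨a, -, rfl⟩ ⟨b, -, h⟩
    cases h

lemma nbcFacet_subset (hI : M.Indep I) : nbcFacet M I ⊆ Vert.y '' M.E ∪ Vert.z '' M.E :=
  union_subset_union
    (image_mono (sdiff_subset.trans (relatedBase_related hI).1.subset_ground))
    (image_mono hI.subset_ground)

lemma isFacet_nbcFacet (hI : I ∈ NBC M) : IsFacet (augNBCComplex M) (nbcFacet M I) := by
  refine ⟨mem_augNBCComplex.2 ⟨I, hI, Subset.rfl⟩, fun F hF hIF => ?_⟩
  obtain ⟨J, hJ, hFJ⟩ := mem_augNBCComplex.1 hF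
  have hJi := indep_of_mem_NBC hJ
  have hfin : (nbcFacet M J).Finite :=
    ((M.ground_finite.image _).union (M.ground_finite.image _)).subset (nbcFacet_subset hJi)
  have heq := (hfin.subset (hIF.trans hFJ)).eq_of_subset_of_encard_le (hIF.trans hFJ)
    (by rw [nbcFacet_encard hJi, nbcFacet_encard (indep_of_mem_NBC hI)])
  exact heq ▸ hFJ

lemma exists_of_isFacet (hF : IsFacet (augNBCComplex M) F) : ∃ I ∈ NBC M, nbcFacet M I = F := by
  obtain ⟨I, hI, h⟩ := mem_augNBCComplex.1 hF.1
  exact ⟨I, hI, (hF.2 (isFacet_nbcFacet hI).1 h).antisymm h⟩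

lemma encard_of_isFacet (hF : IsFacet (augNBCComplex M) F) : F.encard = M.eRank := by
  obtain ⟨I, hI, rfl⟩ := exists_of_isFacet hF
  exact nbcFacet_encard (indep_of_mem_NBC hI)

lemma nbcFacet_inter_sdiff_singleton (hK : M.Indep K) :
    nbcFacet M (K \ {e}) ∩ nbcFacet M K = nbcFacet M K \ {Vert.z e} := by
  have hJ : M.Indep (K \ {e}) := hK.subset sdiff_subset
  ext (a | a | a)
  · simp [nbcFacet]
  · simp only [mem_inter_iff, mem_sdiff, mem_singleton_iff, reduceCtorEq, not_false_eq_true,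
      and_true, and_iff_right_iff_imp]
    intro ha
    rw [y_mem_nbcFacet, relatedBase_eq hK] at ha
    rw [y_mem_nbcFacet, relatedBase_eq hJ]
    -- Membership in `K \ {e}` would force membership in `K`, so the vertex stays a `y`-vertex.
    exact ⟨greedyBase_sdiff_subset sdiff_subset ha, fun h => ha.2 h.1⟩
  · simp only [mem_inter_iff, mem_sdiff, z_mem_nbcFacet, mem_singleton_iff, Vert.z.injEq]
    tauto

lemma isShellingOrder_of_linearExtension (P : LinearOrder {I : Set α // I ∈ NBC M})
    (hP : IsNBCLinearExtension M P) :
    IsShellingOrder (augNBCComplex M) P (fun I => nbcFacet M I.1) := by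
  refine ⟨fun F G hF hG => (encard_of_isFacet hF).trans (encard_of_isFacet hG).symm, ?_,
    ⟨fun I _ => isFacet_nbcFacet I.2, fun I _ J _ h => Subtype.ext (nbcFacet_injective h),
      fun F hF => ?_⟩, fun I K hIK => ?_⟩
  · exact (M.ground_finite.finite_subsets.subset fun I (hI : I ∈ NBC M) => hI.1).to_subtype
  · obtain ⟨I, hI, h⟩ := exists_of_isFacet hF
    exact ⟨⟨I, hI⟩, mem_univ _, h⟩
  -- Inclusion `K ⊆ I` would put `K` before `I`.
  · have hKI : ¬ K.1 ⊆ I.1 := fun h =>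
      ((P.lt_iff_le_not_ge _ _).1 hIK).2 (hP K I (extIntLE_of_subset I.2 h))
    obtain ⟨k, hkK, hkI⟩ := not_subset.1 hKI
    have hJ : K.1 \ {k} ∈ NBC M := (NBC M).lower sdiff_subset K.2
    have hinter := nbcFacet_inter_sdiff_singleton (indep_of_mem_NBC K.2) (e := k)
    refine ⟨⟨K.1 \ {k}, hJ⟩, ?_, Vert.z k, z_mem_nbcFacet.2 hkK, ?_, hinter⟩
    · have hle := hP ⟨_, hJ⟩ K (extIntLE_of_subset K.2 sdiff_subset)
      refine (P.lt_iff_le_not_ge _ _).2 ⟨hle, fun hge => ?_⟩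
      have heq := congrArg Subtype.val (P.le_antisymm _ _ hle hge)
      exact (heq.symm.subset hkK).2 rfl
    · rw [hinter]
      rintro v ⟨hvI, hvK⟩
      refine ⟨hvK, ?_⟩
      rintro rfl
      exact hkI (z_mem_nbcFacet.1 hvI)

end Complexes

end AugNBC

theorem mainTheorem4 {α : Type*} [LinearOrder α] (M : Matroid α) [M.Finite] :
    -- every independent set is related to exactly one basis
    (∀ I : Set α, M.Indep I → ∃! B : Set α, AugNBC.RelatedToBase M I B) ∧
    -- the external/internal order is a partial order on the independent sets
    IsPartialOrder {I : Set α // M.Indep I} (fun I J => AugNBC.ExtIntLE M I.1 J.1) ∧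
    -- the nbc sets are independent
    (∀ I : Set α, I ∈ AugNBC.NBC M → M.Indep I) ∧
    -- the augmented nbc complex lives on the variables `y_e`, `z_e` with `e` in the ground set
    (∀ F ∈ AugNBC.augNBCComplex M, F ⊆ AugNBC.Vert.y '' M.E ∪ AugNBC.Vert.z '' M.E) ∧
    -- it has exactly one facet `G(I)` for each nbc set `I`
    Set.BijOn (AugNBC.nbcFacet M) {I | I ∈ AugNBC.NBC M}
      {G | AugNBC.IsFacet (AugNBC.augNBCComplex M) G} ∧
    -- all facets have as many elements as the rank of `M`
    (∀ G, AugNBC.IsFacet (AugNBC.augNBCComplex M) G → G.encard = M.eRank) ∧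
    -- every linear extension of the external/internal order on the nbc sets gives a shelling
    (∀ P : LinearOrder {I : Set α // I ∈ AugNBC.NBC M}, AugNBC.IsNBCLinearExtension M P →
      AugNBC.IsShellingOrder (AugNBC.augNBCComplex M) P (fun I => AugNBC.nbcFacet M I.1)) ∧
    -- it is a subcomplex of the augmented external activity complex
    AugNBC.augNBCComplex M ≤ AugNBC.augExtComplex M ∧
    -- `S ↦ z_S` identifies `NBC(M)` with its subcomplex induced on the variables `z_e`
    (∀ S : Set α, S ∈ AugNBC.NBC M ↔ AugNBC.Vert.z '' S ∈ AugNBC.augNBCComplex M) := by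
  refine ⟨fun I hI => AugNBC.existsUnique_relatedToBase hI, AugNBC.extIntLE_isPartialOrder M,
    fun I hI => AugNBC.indep_of_mem_NBC hI, fun F hF => ?_,
    ⟨fun I hI => AugNBC.isFacet_nbcFacet hI, AugNBC.nbcFacet_injective.injOn,
      fun F hF => AugNBC.exists_of_isFacet hF⟩,
    fun G hG => AugNBC.encard_of_isFacet hG,
    AugNBC.isShellingOrder_of_linearExtension, fun F hF => ?_,
    fun S => AugNBC.mem_NBC_iff_image_z_mem⟩
  · obtain ⟨I, hI, h⟩ := AugNBC.mem_augNBCComplex.1 hF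
    exact h.trans (AugNBC.nbcFacet_subset (AugNBC.indep_of_mem_NBC hI))
  · obtain ⟨I, hI, h⟩ := AugNBC.mem_augNBCComplex.1 hF
    exact ⟨_, ⟨I, AugNBC.indep_of_mem_NBC hI, rfl⟩, h.trans AugNBC.nbcFacet_subset_extFacet⟩
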